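/- Semigroups are nonempty. A *pseudovariety of semigroups* is a class of finite semigroups closed under taking subsemigroups, homomorphic images and finite direct products (including the empty product). A semigroup $S$ is *equidivisible* if, for all $u,v,x,y\in S$, the equality $uv=xy$ implies that $u=x$ and $v=y$, or that there is $t\in S$ with $ut=x$ and $v=ty$, or that there is $t\in S$ with $xt=u$ and $y=tv$. For a pseudovariety $\mathsf V$ and a finite nonempty alphabet $A$, the free pro-$\mathsf V$ semigroup over $A$ is the inverse limit of the quotients of the free semigroup $A^+$ that belong to $\mathsf V$; the pseudovariety $\mathsf V$ is *equidivisible* if the free pro-$\mathsf V$ semigroup over every finite nonempty alphabet is equidivisible. Let $\mathsf{CS}$ be the pseudovariety of finite completely simple semigroups. For a semigroup $S$, let $S^I$ be $S$ with a new identity $I$ adjoined. Let $\varphi\colon A^+\to S$ be an onto homomorphism, extended to $A^*\to S^I$ by mapping the empty word to $I$. The two-sided Cayley graph $\Gamma_\varphi$ is the directed graph with vertex set $S^I\times S^I$ whose edges are the triples $((s_1,t_1),a,(s_2,t_2))$ with $a\in A$, $s_1\varphi(a)=s_2$ and $t_1=\varphi(a)t_2$. For $u\in A^+$, let $p_u$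 be the unique path labeled $u$ from $(I,\varphi(u))$ to $(\varphi(u),I)$, and let $T(p_u)$ be the set of its transition edges, that is, of those edges of $p_u$ whose source and target lie in different strongly connected components of $\Gamma_\varphi$. The *two-sided Karnofsky–Rhodes expansion* of $S$ with respect to $\varphi$ is $S_\varphi^{K(\ell 1)}=A^+/{\equiv_\varphi}$, where $\equiv_\varphi$ is the congruence such that $u\equiv_\varphi v$ if and only if $\varphi(u)=\varphi(v)$ and $T(p_u)=T(p_v)$. A pseudovariety $\mathsf V$ is *closed under the two-sided Karnofsky–Rhodes expansion* if $S_\varphi^{K(\ell 1)}\in\mathsf V$ whenever $S\in\mathsf V$ and $\varphi$ is a homomorphism from a finitely generated free semigroup onto $S$. **Theorem.** A pseudovariety of semigroups $\mathsf V$ is equidivisible if and only if $\mathsf V$ is contained in $\mathsf{CS}$ or $\mathsf V$ is closed under the two-sided Karnofsky–Rhodes expansion. -/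

import Mathlib

universe u

/-- A semigroup `S` is equidivisible if `u * v = x * y` implies that the two factorizations
coincide, or that one of them refines the other through some `t`. -/
def IsEquidivisible (S : Type u) [Semigroup S] : Prop :=
  ∀ u v x y : S, u * v = x * y →
    (u = x ∧ v = y) ∨ (∃ t : S, u * t = x ∧ v = t * y) ∨ (∃ t : S, x * t = u ∧ y = t * v)

/-- A completely simple semigroup: a nonempty semigroup without proper (two-sided, nonempty)
ideals that has a primitive idempotent, i.e. a minimal one in the natural order of idempotents. -/
def IsCompletelySimple (S : Type u) [Semigroup S] : Prop :=
  (∀ J : Set S, J.Nonempty → (∀ s : S, ∀ x ∈ J, s * x ∈ J ∧ x * s ∈ J) → J = Set.univ) ∧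
  ∃ e : S, e * e = e ∧ ∀ f : S, f * f = f → e * f = f → f * e = f → f = e

/-- A pseudovariety of semigroups: a class of finite (nonempty) semigroups closed under
subsemigroups, homomorphic images and finite direct products (including the empty one). -/
structure SemigroupPseudovariety where
  /-- membership in the class -/
  Mem : (S : Type u) → [Semigroup S] → Prop
  finite_of_mem : ∀ (S : Type u) [Semigroup S], Mem S → Finite S
  nonempty_of_mem : ∀ (S : Type u) [Semigroup S], Mem S → Nonempty S
  mem_trivial : Mem PUnit.{u + 1}
  mem_prod : ∀ (S T : Type u) [Semigroup S] [Semigroup T], Mem S → Mem T → Mem (S × T)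
  mem_subsemigroup : ∀ (S : Type u) [Semigroup S], Mem S →
    ∀ T : Subsemigroup S, (T : Set S).Nonempty → Mem T
  mem_image : ∀ (S T : Type u) [Semigroup S] [Semigroup T] (f : S →ₙ* T),
    Function.Surjective f → Mem S → Mem T

namespace SemigroupPseudovariety

/-- The index set of the inverse system of the `A`-generated members of `V`: the congruences
on the free semigroup `A⁺` whose quotient belongs to `V`. -/
def FreeIndex (V : SemigroupPseudovariety.{u}) (A : Type u) : Type u :=
  {c : Con (FreeSemigroup A) // V.Mem c.Quotient}

/-- The canonical projection `A⁺/c → A⁺/d` for congruences `c ≤ d`. -/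
def conProj {A : Type u} {c d : Con (FreeSemigroup A)} (h : c ≤ d) : c.Quotient →ₙ* d.Quotient where
  toFun := Quotient.map' id fun _ _ hxy => h hxy
  map_mul' := by
    rintro ⟨x⟩ ⟨y⟩
    rfl

/-- The free pro-`V` semigroup over a (nonempty) alphabet `A`: the inverse limit of the
`A`-generated members of `V`, i.e. the compatible families in the product of the
quotients `A⁺/c` lying in `V`. -/
def freePro (V : SemigroupPseudovariety.{u}) (A : Type u) :
    Subsemigroup (∀ c : V.FreeIndex A, c.1.Quotient) where
  carrier := {x | ∀ (c d : V.FreeIndex A) (h : c.1 ≤ d.1), conProj h (x c) = x d}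
  mul_mem' := by
    intro x y hx hy c d h
    simp only [Pi.mul_apply, map_mul, hx c d h, hy c d h]

/-- `V` is equidivisible if all finitely generated free pro-`V` semigroups are. -/
def Equidivisible (V : SemigroupPseudovariety.{u}) : Prop :=
  ∀ (A : Type u) [Finite A] [Nonempty A], IsEquidivisible (V.freePro A)

/-- `V` is contained in the pseudovariety `CS` of finite completely simple semigroups. -/
def ContainedInCS (V : SemigroupPseudovariety.{u}) : Prop :=
  ∀ (S : Type u) [Semigroup S], V.Mem S → IsCompletelySimple S

end SemigroupPseudovariety

namespace KarnofskyRhodes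

variable {A S : Type u} [Semigroup S]

/-- Vertices of the two-sided Cayley graph: pairs of elements of `S^I`, where `S^I = WithOne S`
is `S` with a new identity adjoined (even if `S` has one already). -/
abbrev Vertex (S : Type u) : Type u := WithOne S × WithOne S

/-- Triples (source, letter, target). -/
abbrev Triple (A S : Type u) : Type u := Vertex S × A × Vertex S

/-- The value in `S^I` of a possibly empty word. -/
def val (φ : FreeSemigroup A →ₙ* S) (w : List A) : WithOne S :=
  (w.map fun a => (φ (FreeSemigroup.of a) : WithOne S)).prod

/-- `((s₁, t₁), a, (s₂, t₂))` is an edge of the two-sided Cayley graph of `φ` if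
`s₁ φ(a) = s₂` and `t₁ = φ(a) t₂`. -/
def IsEdge (φ : FreeSemigroup A →ₙ* S) (e : Triple A S) : Prop :=
  e.1.1 * (φ (FreeSemigroup.of e.2.1) : WithOne S) = e.2.2.1 ∧
  e.1.2 = (φ (FreeSemigroup.of e.2.1) : WithOne S) * e.2.2.2

/-- There is a (possibly empty) directed path from `p` to `q`. -/
def Reachable (φ : FreeSemigroup A →ₙ* S) (p q : Vertex S) : Prop :=
  Relation.ReflTransGen (fun x y => ∃ a : A, IsEdge φ (x, a, y)) p q

/-- A transition edge: its ends lie in different strongly connected components. -/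
def IsTransitionEdge (φ : FreeSemigroup A →ₙ* S) (e : Triple A S) : Prop :=
  IsEdge φ e ∧ ¬ (Reachable φ e.1 e.2.2 ∧ Reachable φ e.2.2 e.1)

/-- The underlying list of letters of a nonempty word. -/
def letters (w : FreeSemigroup A) : List A := w.head :: w.tail

/-- The edges of the path `p_w` labeled `w` from `(I, φ(w))` to `(φ(w), I)`: for each factorization
`w = w₁ a w₂` with `a` a letter, the edge from `(φ(w₁), φ(a w₂))` to `(φ(w₁ a), φ(w₂))`. -/
def pathEdges (φ : FreeSemigroup A →ₙ* S) (w : FreeSemigroup A) : Set (Triple A S) :=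
  {e | ∃ (w₁ : List A) (a : A) (w₂ : List A), letters w = w₁ ++ a :: w₂ ∧
    e = ((val φ w₁, val φ (a :: w₂)), a, (val φ (w₁ ++ [a]), val φ w₂))}

/-- The set `T(p_w)` of transition edges in the path `p_w`. -/
def transitionEdges (φ : FreeSemigroup A →ₙ* S) (w : FreeSemigroup A) : Set (Triple A S) :=
  {e | e ∈ pathEdges φ w ∧ IsTransitionEdge φ e}

theorem val_append (φ : FreeSemigroup A →ₙ* S) (v w : List A) :
    val φ (v ++ w) = val φ v * val φ w := by
  simp [val]

theorem letters_mul (v w : FreeSemigroup A) : letters (v * w) = letters v ++ letters w := by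
  simp [letters]

theorem val_letters (φ : FreeSemigroup A →ₙ* S) (w : FreeSemigroup A) :
    val φ (letters w) = (φ w : WithOne S) := by
  induction w using FreeSemigroup.recOnMul with
  | ih1 a => simp [val, letters, FreeSemigroup.of]
  | ih2 a w h₁ h₂ => rw [letters_mul, val_append, h₁, h₂, map_mul, WithOne.coe_mul]

/-- Multiplying the first coordinates on the left by `l` and the second ones on the right by `r`. -/
def shift (l r : WithOne S) (p : Vertex S) : Vertex S := (l * p.1, p.2 * r)

theorem IsEdge.shift {φ : FreeSemigroup A →ₙ* S} {p q : Vertex S} {a : A}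
    (h : IsEdge φ (p, a, q)) (l r : WithOne S) :
    IsEdge φ (KarnofskyRhodes.shift l r p, a, KarnofskyRhodes.shift l r q) := by
  obtain ⟨h₁, h₂⟩ := h
  simp only at h₁ h₂
  constructor <;> simp [KarnofskyRhodes.shift, ← h₁, h₂, mul_assoc]

theorem Reachable.shift {φ : FreeSemigroup A →ₙ* S} {p q : Vertex S}
    (h : Reachable φ p q) (l r : WithOne S) :
    Reachable φ (KarnofskyRhodes.shift l r p) (KarnofskyRhodes.shift l r q) :=
  Relation.ReflTransGen.lift (p := fun x y => ∃ a : A, IsEdge φ (x, a, y))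
    (fun v => KarnofskyRhodes.shift l r v) (fun _ _ ha => ⟨ha.choose, ha.choose_spec.shift l r⟩) _ _ h

theorem isEdge_of_mem_pathEdges {φ : FreeSemigroup A →ₙ* S} {w : FreeSemigroup A}
    {e : Triple A S} (h : e ∈ pathEdges φ w) : IsEdge φ e := by
  obtain ⟨w₁, a, w₂, -, rfl⟩ := h
  constructor <;> simp [val]

theorem mem_pathEdges_mul (φ : FreeSemigroup A →ₙ* S) (v w : FreeSemigroup A) (e : Triple A S) :
    e ∈ pathEdges φ (v * w) ↔
      (∃ d ∈ pathEdges φ v, e = (shift 1 (φ w) d.1, d.2.1, shift 1 (φ w) d.2.2)) ∨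
      (∃ d ∈ pathEdges φ w, e = (shift (φ v) 1 d.1, d.2.1, shift (φ v) 1 d.2.2)) := by
  constructor
  · rintro ⟨w₁, a, w₂, hw, rfl⟩
    rw [letters_mul, List.append_eq_append_iff] at hw
    rcases hw with ⟨m, rfl, hm⟩ | ⟨m, hv, hm⟩
    · refine Or.inr ⟨_, ⟨m, a, w₂, hm, rfl⟩, ?_⟩
      simp [shift, val_append, val_letters]
    · rcases m with _ | ⟨b, m⟩
      · refine Or.inr ⟨_, ⟨[], a, w₂, by simpa using hm.symm, rfl⟩, ?_⟩
        have h : val φ w₁ = (φ v : WithOne S) := by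
          rw [← val_letters, hv, List.append_nil]
        rw [val_append, h]
        simp [shift, val]
      · simp only [List.cons_append, List.cons.injEq] at hm
        obtain ⟨rfl, rfl⟩ := hm
        refine Or.inl ⟨_, ⟨w₁, a, m, hv, rfl⟩, ?_⟩
        have h : val φ (a :: (m ++ letters w)) = val φ (a :: m) * (φ w : WithOne S) := by
          rw [← val_letters, ← val_append, List.cons_append]
        simp [shift, h, val_append, val_letters]
  · rintro (⟨_, ⟨w₁, a, w₂, hw, rfl⟩, rfl⟩ | ⟨_, ⟨w₁, a, w₂, hw, rfl⟩, rfl⟩)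
    · refine ⟨w₁, a, w₂ ++ letters w, by rw [letters_mul, hw]; simp, ?_⟩
      have h : val φ (a :: (w₂ ++ letters w)) = val φ (a :: w₂) * (φ w : WithOne S) := by
        rw [← val_letters, ← val_append, List.cons_append]
      simp [shift, h, val_append, val_letters]
    · refine ⟨letters v ++ w₁, a, w₂, by rw [letters_mul, hw]; simp, ?_⟩
      simp [shift, val_append, val_letters]

theorem isTransitionEdge_of_shift {φ : FreeSemigroup A →ₙ* S} {d : Triple A S} {l r : WithOne S}
    (hd : IsEdge φ d) (h : IsTransitionEdge φ (shift l r d.1, d.2.1, shift l r d.2.2)) :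
    IsTransitionEdge φ d :=
  ⟨hd, fun hr => h.2 ⟨hr.1.shift l r, hr.2.shift l r⟩⟩

theorem transitionEdges_mul_subset {φ : FreeSemigroup A →ₙ* S} {v v' w w' : FreeSemigroup A}
    (hv : φ v = φ v') (hw : φ w = φ w') (hv' : transitionEdges φ v ⊆ transitionEdges φ v')
    (hw' : transitionEdges φ w ⊆ transitionEdges φ w') :
    transitionEdges φ (v * w) ⊆ transitionEdges φ (v' * w') := by
  rintro e ⟨he, ht⟩
  refine ⟨?_, ht⟩
  rw [mem_pathEdges_mul] at he ⊢
  rw [← hv, ← hw]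
  rcases he with ⟨d, hd, rfl⟩ | ⟨d, hd, rfl⟩
  · exact Or.inl ⟨d, (hv' ⟨hd, isTransitionEdge_of_shift (isEdge_of_mem_pathEdges hd) ht⟩).1, rfl⟩
  · exact Or.inr ⟨d, (hw' ⟨hd, isTransitionEdge_of_shift (isEdge_of_mem_pathEdges hd) ht⟩).1, rfl⟩

/-- The congruence `≡_φ` on `A⁺`: `v ≡ w` iff `φ(v) = φ(w)` and `T(p_v) = T(p_w)`. -/
def congruence (φ : FreeSemigroup A →ₙ* S) : Con (FreeSemigroup A) where
  r v w := φ v = φ w ∧ transitionEdges φ v = transitionEdges φ w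
  iseqv :=
    ⟨fun _ => ⟨rfl, rfl⟩, fun h => ⟨h.1.symm, h.2.symm⟩,
      fun h h' => ⟨h.1.trans h'.1, h.2.trans h'.2⟩⟩
  mul' := by
    rintro v v' w w' ⟨hv, hv'⟩ ⟨hw, hw'⟩
    refine ⟨by rw [map_mul, map_mul, hv, hw], Set.Subset.antisymm ?_ ?_⟩
    · exact transitionEdges_mul_subset hv hw hv'.subset hw'.subset
    · exact transitionEdges_mul_subset hv.symm hw.symm hv'.symm.subset hw'.symm.subset

/-- The two-sided Karnofsky-Rhodes expansion of `S` with respect to `φ : A⁺ → S`. -/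
abbrev Expansion (φ : FreeSemigroup A →ₙ* S) : Type u := (congruence φ).Quotient

end KarnofskyRhodes

/-- `V` is closed under the two-sided Karnofsky-Rhodes expansion: the expansion of every `S` in `V`
with respect to every homomorphism from a finitely generated free semigroup onto `S` is in `V`. -/
def SemigroupPseudovariety.ClosedUnderKR (V : SemigroupPseudovariety.{u}) : Prop :=
  ∀ (A S : Type u) [Finite A] [Semigroup S] (φ : FreeSemigroup A →ₙ* S),
    Function.Surjective φ → V.Mem S → V.Mem (KarnofskyRhodes.Expansion φ)

open KarnofskyRhodes Filter

/-! With an identity adjoined, equidivisibility has two alternatives: `u * t = x ∧ v = t * y`, or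
the same with the factorizations exchanged. In the two-sided Cayley graph the first says exactly
that (u, v) reaches (x, y) (`reachable_iff`). By compactness it suffices to refine in each finite
quotient.

Sufficiency. In a finite completely simple semigroup any two factorizations of an element refine
each other. If `V` is closed under the expansion, an equality uv = xy is read in the expansion of a
given quotient: representing words have the same transition edges, so any vertices on their two
paths are comparable.

Necessity. Let `V` be equidivisible and not inside CS; it then has a nontrivial member with a zero.
Some member has an indecomposable element: otherwise s ∈ s²S throughout, so ab = (ab)(ab)z in the
free pro-`V` semigroup on a, b, and refining a·b against ab·abz makes a a multiple of b or b a
multiple of a, which the zero forbids. Indecomposability makes letters irreducible and left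
cancellable, so two letter occurrences in a pseudoword are ordered as in a word (`compare_letters`).
Were an expansion outside `V`, every quotient in `V` would identify two words told apart by a
transition edge. The limit of such pairs is one pseudoword with two marked letters
(`exists_splittings`), and each relative position of these is contradictory. -/

theorem WithOne.finite {S : Type*} [Finite S] : Finite (WithOne S) :=
  inferInstanceAs (Finite (Option S))

/-- In an equidivisible semigroup with an identity adjoined, any two factorizations of an
element have a common refinement. -/
theorem IsEquidivisible.withOne {S : Type u} [Semigroup S] (hS : IsEquidivisible S)
    {u v x y : WithOne S} (h : u * v = x * y) :
    ∃ t : WithOne S, (u * t = x ∧ v = t * y) ∨ (x * t = u ∧ y = t * v) := by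
  induction u with
  | one => exact ⟨x, Or.inl ⟨one_mul x, by simpa using h⟩⟩
  | coe u =>
  induction x with
  | one => exact ⟨u, Or.inr ⟨one_mul _, by simpa using h.symm⟩⟩
  | coe x =>
  induction v with
  | one => exact ⟨y, Or.inr ⟨by simpa using h.symm, (mul_one y).symm⟩⟩
  | coe v =>
  induction y with
  | one => exact ⟨v, Or.inl ⟨by simpa using h, (mul_one _).symm⟩⟩
  | coe y =>
  simp only [← WithOne.coe_mul, WithOne.coe_inj] at h
  rcases hS u v x y h with ⟨rfl, rfl⟩ | ⟨t, rfl, rfl⟩ | ⟨t, rfl, rfl⟩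
  · exact ⟨1, Or.inl ⟨mul_one _, (one_mul _).symm⟩⟩
  · exact ⟨t, Or.inl ⟨rfl, rfl⟩⟩
  · exact ⟨t, Or.inr ⟨rfl, rfl⟩⟩

theorem isEquidivisible_of_withOne {S : Type u} [Semigroup S]
    (h : ∀ u v x y : S, u * v = x * y →
      ∃ t : WithOne S, ((u : WithOne S) * t = x ∧ (v : WithOne S) = t * y) ∨
        ((x : WithOne S) * t = u ∧ (y : WithOne S) = t * v)) : IsEquidivisible S := by
  intro u v x y huv
  obtain ⟨t, ht⟩ := h u v x y huv
  induction t with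
  | one =>
    simp only [mul_one, one_mul, WithOne.coe_inj] at ht
    rcases ht with ⟨rfl, rfl⟩ | ⟨rfl, rfl⟩ <;> exact Or.inl ⟨rfl, rfl⟩
  | coe t =>
    simp only [← WithOne.coe_mul, WithOne.coe_inj] at ht
    rcases ht with ⟨h₁, h₂⟩ | ⟨h₁, h₂⟩
    · exact Or.inr (Or.inl ⟨t, h₁, h₂⟩)
    · exact Or.inr (Or.inr ⟨t, h₁, h₂⟩)

/-! ### Values of words and reachability in the Cayley graph -/

namespace KarnofskyRhodes

variable {A S T : Type u} [Semigroup S] [Semigroup T]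

theorem val_comp (φ : FreeSemigroup A →ₙ* S) (f : S →ₙ* T) (w : List A) :
    val (f.comp φ) w = WithOne.mapMulHom f (val φ w) := by
  simp [val, map_list_prod, Function.comp_def]

theorem exists_letters {w : List A} (hw : w ≠ []) : ∃ v : FreeSemigroup A, letters v = w := by
  cases w with
  | nil => exact absurd rfl hw
  | cons a w => exact ⟨⟨a, w⟩, rfl⟩

theorem val_nil (φ : FreeSemigroup A →ₙ* S) : val φ [] = 1 := by simp [val]

theorem val_singleton (φ : FreeSemigroup A →ₙ* S) (a : A) :
    val φ [a] = (φ (FreeSemigroup.of a) : WithOne S) := by simp [val]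

theorem val_cons (φ : FreeSemigroup A →ₙ* S) (a : A) (w : List A) :
    val φ (a :: w) = (φ (FreeSemigroup.of a) : WithOne S) * val φ w := by simp [val]

theorem val_ne_one (φ : FreeSemigroup A →ₙ* S) {w : List A} (hw : w ≠ []) : val φ w ≠ 1 := by
  obtain ⟨v, rfl⟩ := exists_letters hw
  rw [val_letters]
  exact WithOne.coe_ne_one

theorem exists_val_eq {φ : FreeSemigroup A →ₙ* S} (hφ : Function.Surjective φ) (x : WithOne S) :
    ∃ w : List A, val φ w = x := by
  induction x with
  | one => exact ⟨[], val_nil φ⟩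
  | coe x =>
    obtain ⟨w, rfl⟩ := hφ x
    exact ⟨letters w, val_letters φ w⟩

theorem reachable_val (φ : FreeSemigroup A →ₙ* S) (w : List A) (s t : WithOne S) :
    Reachable φ (s, val φ w * t) (s * val φ w, t) := by
  induction w generalizing s with
  | nil =>
    rw [val_nil, one_mul, mul_one]
    exact Relation.ReflTransGen.refl
  | cons a w ih =>
    refine Relation.ReflTransGen.head (b := (s * (φ (FreeSemigroup.of a) : WithOne S), val φ w * t))
      ⟨a, rfl, by simp [val_cons, mul_assoc]⟩ ?_
    rw [val_cons, ← mul_assoc]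
    exact ih _

/-- The label of a path has value `x`, and surjectivity supplies a label for any `x`. This
translates refinement of factorizations into reachability. -/
theorem reachable_iff {φ : FreeSemigroup A →ₙ* S} (hφ : Function.Surjective φ) {p q : Vertex S} :
    Reachable φ p q ↔ ∃ x : WithOne S, p.1 * x = q.1 ∧ p.2 = x * q.2 := by
  constructor
  · intro h
    induction h with
    | refl => exact ⟨1, mul_one _, (one_mul _).symm⟩
    | tail _ h ih =>
      obtain ⟨x, h₁, h₂⟩ := ih
      obtain ⟨a, h₃, h₄⟩ := h
      simp only at h₃ h₄
      exact ⟨x * (φ (FreeSemigroup.of a) : WithOne S), by rw [← mul_assoc, h₁, h₃],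
        by rw [h₂, h₄, mul_assoc]⟩
  · rintro ⟨x, h₁, h₂⟩
    obtain ⟨w, rfl⟩ := exists_val_eq hφ x
    have := reachable_val φ w p.1 q.2
    rwa [h₁, ← h₂] at this

end KarnofskyRhodes

/-! ### The inverse system of quotients and its limit -/

namespace SemigroupPseudovariety

variable {V : SemigroupPseudovariety.{u}} {A : Type u}

theorem mem_of_injective {S T : Type u} [Semigroup S] [Semigroup T] [Nonempty S] (f : S →ₙ* T)
    (hf : Function.Injective f) (hT : V.Mem T) : V.Mem S := by
  have hR : V.Mem f.srange := V.mem_subsemigroup T hT _ (by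
    rw [MulHom.coe_srange]; exact Set.range_nonempty f)
  have hbij : Function.Bijective f.srangeRestrict :=
    ⟨fun x y h => hf (congrArg Subtype.val h), f.srangeRestrict_surjective⟩
  let e := MulEquiv.ofBijective f.srangeRestrict hbij
  exact V.mem_image _ _ (e.symm : f.srange →ₙ* S) e.symm.surjective hR

/-- The projection of the free semigroup on its quotient by a congruence. -/
def quotientHom (c : Con (FreeSemigroup A)) : FreeSemigroup A →ₙ* c.Quotient where
  toFun w := (w : c.Quotient)
  map_mul' _ _ := rfl

theorem quotientHom_surjective (c : Con (FreeSemigroup A)) :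
    Function.Surjective (quotientHom c) := Quotient.mk''_surjective

theorem quotientHom_eq_iff {c : Con (FreeSemigroup A)} {v w : FreeSemigroup A} :
    quotientHom c v = quotientHom c w ↔ c v w := Con.eq c

theorem conProj_comp_quotientHom {c d : Con (FreeSemigroup A)} (h : c ≤ d) :
    (conProj h).comp (quotientHom c) = quotientHom d := rfl

/-- The factorization of a homomorphism through the quotient by its kernel. -/
def kerHom {T : Type u} [Semigroup T] (ψ : FreeSemigroup A →ₙ* T) : (Con.ker ψ).Quotient →ₙ* T where
  toFun x := Con.liftOn x ψ fun _ _ h => h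
  map_mul' := by
    rintro ⟨x⟩ ⟨y⟩
    exact map_mul ψ x y

theorem kerHom_injective {T : Type u} [Semigroup T] (ψ : FreeSemigroup A →ₙ* T) :
    Function.Injective (kerHom ψ) := by
  rintro ⟨x⟩ ⟨y⟩ h
  exact (Con.eq _).2 h

theorem mem_quotient_of_le {c d : Con (FreeSemigroup A)} (h : c ≤ d) (hc : V.Mem c.Quotient) :
    V.Mem d.Quotient :=
  V.mem_image _ _ (conProj h) (by
    rintro ⟨x⟩
    exact ⟨quotientHom c x, rfl⟩) hc

instance : PartialOrder (V.FreeIndex A) :=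
  inferInstanceAs (PartialOrder {c : Con (FreeSemigroup A) // V.Mem c.Quotient})

section

variable [Nonempty A]

theorem mem_quotient_ker {T : Type u} [Semigroup T] (hT : V.Mem T) (ψ : FreeSemigroup A →ₙ* T) :
    V.Mem (Con.ker ψ).Quotient :=
  have : Nonempty (Con.ker ψ).Quotient := ⟨quotientHom _ (FreeSemigroup.of (Classical.arbitrary A))⟩
  mem_of_injective (kerHom ψ) (kerHom_injective ψ) hT

/-- The kernel of a homomorphism to a member of `V`. -/
def kerIndex {T : Type u} [Semigroup T] (hT : V.Mem T) (ψ : FreeSemigroup A →ₙ* T) :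
    V.FreeIndex A := ⟨Con.ker ψ, mem_quotient_ker hT ψ⟩

instance : Nonempty (V.FreeIndex A) :=
  ⟨kerIndex V.mem_trivial ⟨fun _ => PUnit.unit, fun _ _ => rfl⟩⟩

/-- The quotient by the kernel of the paired projections embeds in the product of the two quotients.
This makes `atBot` a proper filter, finer congruences being lower. -/
instance : IsCodirectedOrder (V.FreeIndex A) where
  directed c d := by
    refine ⟨kerIndex (V.mem_prod _ _ c.2 d.2) ((quotientHom c.1).prod (quotientHom d.1)), ?_, ?_⟩
    · intro x y h
      exact (Con.eq _).1 (congrArg Prod.fst (show (_ : _ × _) = _ from h))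
    · intro x y h
      exact (Con.eq _).1 (congrArg Prod.snd (show (_ : _ × _) = _ from h))

end

instance (c : V.FreeIndex A) : Finite c.1.Quotient := V.finite_of_mem _ c.2

instance (c : V.FreeIndex A) : Finite (WithOne c.1.Quotient) := WithOne.finite

/-- The projection of the free pro-`V` semigroup on one of its defining quotients. -/
def proj (c : V.FreeIndex A) : V.freePro A →ₙ* c.1.Quotient where
  toFun x := x.1 c
  map_mul' _ _ := rfl

/-- The projection with identities adjoined. -/
def projOne (c : V.FreeIndex A) : WithOne (V.freePro A) →* WithOne c.1.Quotient :=
  WithOne.mapMulHom (proj c)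

theorem projOne_coe (c : V.FreeIndex A) (x : V.freePro A) :
    projOne c (x : WithOne (V.freePro A)) = (x.1 c : WithOne c.1.Quotient) := rfl

theorem mapMulHom_conProj_projOne {c d : V.FreeIndex A} (h : c.1 ≤ d.1)
    (x : WithOne (V.freePro A)) :
    WithOne.mapMulHom (conProj h) (projOne c x) = projOne d x := by
  induction x with
  | one => simp
  | coe x =>
    rw [projOne_coe, projOne_coe, WithOne.mapMulHom_coe, x.2 c d h]

theorem mapMulHom_conProj_val {c d : V.FreeIndex A} (h : c.1 ≤ d.1) (w : List A) :
    WithOne.mapMulHom (conProj h) (val (quotientHom c.1) w) = val (quotientHom d.1) w := by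
  rw [← val_comp, conProj_comp_quotientHom]

theorem projOne_ext [Nonempty A] {x y : WithOne (V.freePro A)}
    (h : ∀ c : V.FreeIndex A, projOne c x = projOne c y) : x = y := by
  have c₀ : V.FreeIndex A := Classical.arbitrary _
  induction x with
  | one =>
    induction y with
    | one => rfl
    | coe y => exact absurd ((h c₀).symm.trans (map_one _)) WithOne.coe_ne_one
  | coe x =>
    induction y with
    | one => exact absurd ((h c₀).trans (map_one _)) WithOne.coe_ne_one
    | coe y => exact WithOne.coe_inj.2 (Subtype.ext (funext fun c => WithOne.coe_inj.1 (h c)))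

/-- The image of a word in the free pro-`V` semigroup. -/
def wordHom : FreeSemigroup A →ₙ* V.freePro A where
  toFun w := ⟨fun c => quotientHom c.1 w, fun _ _ _ => rfl⟩
  map_mul' _ _ := rfl

theorem projOne_val_wordHom (c : V.FreeIndex A) (w : List A) :
    projOne c (val wordHom w) = val (quotientHom c.1) w := by
  rw [projOne, ← val_comp]
  rfl

/-- The continuous extension to the free pro-`V` semigroup of a homomorphism to a member of `V`. -/
def extend [Nonempty A] {T : Type u} [Semigroup T] (hT : V.Mem T) (ψ : FreeSemigroup A →ₙ* T) :
    V.freePro A →ₙ* T := (kerHom ψ).comp (proj (kerIndex hT ψ))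

theorem extend_wordHom [Nonempty A] {T : Type u} [Semigroup T] (hT : V.Mem T)
    (ψ : FreeSemigroup A →ₙ* T) (w : FreeSemigroup A) : extend hT ψ (wordHom w) = ψ w := rfl

/-! ### Limits of words and compactness -/

section Limits

variable [Nonempty A]

variable (V A) in
/-- An ultrafilter of indices converging to the free pro-`V` semigroup. -/
noncomputable def indexUltrafilter : Ultrafilter (V.FreeIndex A) := Ultrafilter.of atBot

theorem eventually_le (d : V.FreeIndex A) : ∀ᶠ c : V.FreeIndex A in indexUltrafilter V A, c.1 ≤ d.1 :=
  Ultrafilter.of_le _ (eventually_le_atBot d)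

theorem _root_.Ultrafilter.exists_eventually_eq {α β : Type*} [Finite β] (U : Ultrafilter α)
    (f : α → β) : ∃ b, ∀ᶠ x in U, f x = b := by
  obtain ⟨b, hb⟩ := Ultrafilter.eq_pure_of_finite (U.map f)
  refine ⟨b, ?_⟩
  have : {b} ∈ U.map f := by rw [hb]; exact Set.mem_singleton b
  exact this

/-- The family of words `w` converges to `x` along the ultrafilter of indices. -/
def IsLim (w : V.FreeIndex A → List A) (x : WithOne (V.freePro A)) : Prop :=
  ∀ d : V.FreeIndex A, ∀ᶠ c in indexUltrafilter V A, val (quotientHom d.1) (w c) = projOne d x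

theorem exists_isLim (w : V.FreeIndex A → List A) : ∃ x, IsLim w x := by
  -- Only nonempty words have values in the quotients themselves; the limit of empty words is the
  -- adjoined identity.
  by_cases hw : ∀ᶠ c in indexUltrafilter V A, w c = []
  · refine ⟨1, fun d => hw.mono fun c hc => ?_⟩
    rw [hc, val_nil, map_one]
  rw [← Ultrafilter.eventually_not] at hw
  choose x hx using fun d : V.FreeIndex A =>
    (indexUltrafilter V A).exists_eventually_eq fun c => val (quotientHom d.1) (w c)
  have hx₁ (d) : ∃ y : d.1.Quotient, (y : WithOne d.1.Quotient) = x d := by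
    obtain ⟨c, h₁, h₂⟩ := (hw.and (hx d)).exists
    rw [← WithOne.ne_one_iff_exists, ← h₂]
    exact val_ne_one _ h₁
  choose y hy using hx₁
  refine ⟨((⟨y, fun c d h => ?_⟩ : V.freePro A) : WithOne (V.freePro A)), fun d => ?_⟩
  · obtain ⟨e, h₁, h₂⟩ := ((hx c).and (hx d)).exists
    rw [← WithOne.coe_inj, ← WithOne.mapMulHom_coe, hy, hy, ← h₁, ← h₂, mapMulHom_conProj_val]
  · rw [projOne_coe, hy]
    exact hx d

namespace IsLim

variable {v w : V.FreeIndex A → List A} {x y : WithOne (V.freePro A)}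

theorem unique (h₁ : IsLim w x) (h₂ : IsLim w y) : x = y := by
  refine projOne_ext fun d => ?_
  obtain ⟨c, h₁, h₂⟩ := ((h₁ d).and (h₂ d)).exists
  exact h₁.symm.trans h₂

theorem append (h₁ : IsLim v x) (h₂ : IsLim w y) : IsLim (fun c => v c ++ w c) (x * y) :=
  fun d => ((h₁ d).and (h₂ d)).mono fun c hc => by rw [val_append, hc.1, hc.2, map_mul]

theorem const (w : List A) : IsLim (fun _ : V.FreeIndex A => w) (val wordHom w) :=
  fun d => Eventually.of_forall fun c => by rw [projOne_val_wordHom]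

/-- Agreement of the `c`-th words modulo `c` alone suffices, since `c` eventually lies below any
fixed index. -/
theorem congr (h : IsLim v x)
    (hvw : ∀ᶠ c in indexUltrafilter V A, val (quotientHom c.1) (v c) = val (quotientHom c.1) (w c)) :
    IsLim w x := by
  intro d
  filter_upwards [h d, hvw, eventually_le d] with c h₁ h₂ h₃
  rw [← h₁, ← mapMulHom_conProj_val h₃, ← h₂, mapMulHom_conProj_val]

theorem eventually_val {T : Type u} [Semigroup T] (hT : V.Mem T) (ψ : FreeSemigroup A →ₙ* T)
    (h : IsLim w x) :
    ∀ᶠ c in indexUltrafilter V A, val ψ (w c) = WithOne.mapMulHom (extend hT ψ) x := by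
  filter_upwards [h (kerIndex hT ψ)] with c hc
  exact (val_comp _ (kerHom ψ) _).trans
    ((congrArg (WithOne.mapMulHom (kerHom ψ)) hc).trans (WithOne.mapMulHom_mapMulHom _ _ _))

end IsLim

/-- Compactness of the free pro-`V` semigroup: a condition compatible with projections that can be
satisfied in the defining quotients can be satisfied in the limit. -/
theorem exists_forall_projOne (P : ∀ c : V.FreeIndex A, WithOne c.1.Quotient → Prop)
    (hP : ∀ (c d : V.FreeIndex A) (h : c.1 ≤ d.1) (t), P c t → P d (WithOne.mapMulHom (conProj h) t))
    (h : ∀ᶠ c in indexUltrafilter V A, ∃ t, P c t) :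
    ∃ t : WithOne (V.freePro A), ∀ c, P c (projOne c t) := by
  have h' : ∀ c : V.FreeIndex A, ∃ w : List A, (∃ t, P c t) → P c (val (quotientHom c.1) w) := by
    intro c
    by_cases hc : ∃ t, P c t
    · obtain ⟨t, ht⟩ := hc
      obtain ⟨w, rfl⟩ := exists_val_eq (quotientHom_surjective c.1) t
      exact ⟨w, fun _ => ht⟩
    · exact ⟨[], fun h => absurd h hc⟩
  choose w hw using h'
  obtain ⟨t, ht⟩ := exists_isLim w
  refine ⟨t, fun d => ?_⟩
  obtain ⟨c, h₁, h₂, h₃⟩ := (h.and ((ht d).and (eventually_le d))).exists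
  have := hP c d h₃ _ (hw c h₁)
  rwa [mapMulHom_conProj_val, h₂] at this

theorem exists_refinement {u v x y : WithOne (V.freePro A)}
    (h : ∀ᶠ c in indexUltrafilter V A, ∃ t : WithOne c.1.Quotient,
      projOne c u * t = projOne c x ∧ projOne c v = t * projOne c y) :
    ∃ t : WithOne (V.freePro A), u * t = x ∧ v = t * y := by
  obtain ⟨t, ht⟩ := exists_forall_projOne
    (fun c t => projOne c u * t = projOne c x ∧ projOne c v = t * projOne c y)
    (fun c d h t ht => by
      have h₁ := congrArg (WithOne.mapMulHom (conProj h)) ht.1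
      have h₂ := congrArg (WithOne.mapMulHom (conProj h)) ht.2
      simp only [map_mul, mapMulHom_conProj_projOne] at h₁ h₂
      exact ⟨h₁, h₂⟩) h
  exact ⟨t, projOne_ext fun c => by rw [map_mul, (ht c).1],
    projOne_ext fun c => by rw [map_mul, (ht c).2]⟩

end Limits

/-- The free pro-`V` semigroup is equidivisible if any two factorizations of an element have a
common refinement in each of the defining quotients. -/
theorem isEquidivisible_freePro [Nonempty A]
    (h : ∀ u v x y : V.freePro A, u * v = x * y → ∀ c : V.FreeIndex A,
      ∃ t : WithOne c.1.Quotient,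
        ((u.1 c : WithOne c.1.Quotient) * t = x.1 c ∧ (v.1 c : WithOne c.1.Quotient) = t * y.1 c) ∨
        ((x.1 c : WithOne c.1.Quotient) * t = u.1 c ∧ (y.1 c : WithOne c.1.Quotient) = t * v.1 c)) :
    IsEquidivisible (V.freePro A) := by
  refine isEquidivisible_of_withOne fun u v x y huv => ?_
  have h' := Eventually.of_forall (f := (indexUltrafilter V A : Filter _)) fun c =>
    exists_or.1 (h u v x y huv c)
  -- The direction of refinement may vary with the quotient; the ultrafilter selects one that occurs
  -- at arbitrarily fine levels.
  rcases Ultrafilter.eventually_or.1 h' with h' | h'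
  · obtain ⟨t, ht⟩ := exists_refinement (V := V) (A := A) (u := u) (v := v)
      (x := x) (y := y) h'
    exact ⟨t, Or.inl ht⟩
  · obtain ⟨t, ht⟩ := exists_refinement (V := V) (A := A) (u := x) (v := y)
      (x := u) (y := v) h'
    exact ⟨t, Or.inr ht⟩

end SemigroupPseudovariety

/-! ### Completely simple semigroups -/

namespace IsCompletelySimple

variable {S : Type u} [Semigroup S]

theorem exists_eq_mul_mul (hS : IsCompletelySimple S) (p x : S) : ∃ a b, x = a * p * b := by
  have := hS.1 {z | ∃ a b, z = a * p * b} ⟨p * p * p, p, p, rfl⟩ (by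
    rintro s _ ⟨a, b, rfl⟩
    exact ⟨⟨s * a, b, by simp only [mul_assoc]⟩, ⟨a, b * s, by simp only [mul_assoc]⟩⟩)
  exact Set.eq_univ_iff_forall.1 this x

/-- In a finite completely simple semigroup, `x` is a right multiple of `x * y`. -/
theorem exists_mul_mul_eq_left [Finite S] (hS : IsCompletelySimple S) (x y : S) :
    ∃ r, x * y * r = x := by
  obtain ⟨a, b, hx⟩ := hS.exists_eq_mul_mul (x * y) x
  -- Counting: left multiplication by `a` carries xyS onto a set containing xS ∪ {x}, which contains
  -- xyS, so finiteness forces xyS = xS ∪ {x}.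
  have hsub : Set.range (fun r => x * y * r) ⊆ insert x (Set.range (fun r => x * r)) := by
    rintro _ ⟨r, rfl⟩
    exact Or.inr ⟨y * r, (mul_assoc _ _ _).symm⟩
  have himg : insert x (Set.range (fun r => x * r)) ⊆
      (fun z => a * z) '' Set.range (fun r => x * y * r) := by
    rintro _ (rfl | ⟨r, rfl⟩)
    · exact ⟨_, ⟨b, rfl⟩, (mul_assoc _ _ _).symm.trans hx.symm⟩
    · exact ⟨_, ⟨b * r, rfl⟩, by
        simp only
        rw [← mul_assoc (x * y), ← mul_assoc a, ← mul_assoc a, ← hx]⟩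
  have heq := Set.eq_of_subset_of_ncard_le hsub
    ((Set.ncard_le_ncard himg (Set.toFinite _)).trans (Set.ncard_image_le (Set.toFinite _)))
    (Set.toFinite _)
  have : x ∈ Set.range (fun r => x * y * r) := heq ▸ Set.mem_insert _ _
  exact this

/-- In a finite completely simple semigroup, `x` is a left multiple of `y * x`. -/
theorem exists_mul_mul_eq_right [Finite S] (hS : IsCompletelySimple S) (x y : S) :
    ∃ r, r * (y * x) = x := by
  obtain ⟨a, b, hx⟩ := hS.exists_eq_mul_mul (y * x) x
  have hsub : Set.range (fun r => r * (y * x)) ⊆ insert x (Set.range (fun r => r * x)) := by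
    rintro _ ⟨r, rfl⟩
    exact Or.inr ⟨r * y, mul_assoc _ _ _⟩
  have himg : insert x (Set.range (fun r => r * x)) ⊆
      (fun z => z * b) '' Set.range (fun r => r * (y * x)) := by
    rintro _ (rfl | ⟨r, rfl⟩)
    · exact ⟨_, ⟨a, rfl⟩, hx.symm⟩
    · exact ⟨_, ⟨r * a, rfl⟩, by
        simp only
        rw [mul_assoc r, mul_assoc r, ← hx]⟩
  have heq := Set.eq_of_subset_of_ncard_le hsub
    ((Set.ncard_le_ncard himg (Set.toFinite _)).trans (Set.ncard_image_le (Set.toFinite _)))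
    (Set.toFinite _)
  have : x ∈ Set.range (fun r => r * (y * x)) := heq ▸ Set.mem_insert _ _
  exact this

theorem exists_refinement [Finite S] (hS : IsCompletelySimple S) {u v x y : S}
    (h : u * v = x * y) : ∃ t, u * t = x ∧ v = t * y := by
  obtain ⟨r, hr⟩ := hS.exists_mul_mul_eq_left x y
  obtain ⟨r', hr'⟩ := hS.exists_mul_mul_eq_right v u
  -- With xyr = x and r'uv = v: ur'x = ur'(xy)r = u(r'uv)r = uvr = xyr = x.
  refine ⟨r' * x, ?_, by rw [mul_assoc, ← h, hr']⟩
  rw [← hr, ← h, ← mul_assoc r', hr', mul_assoc]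

end IsCompletelySimple

theorem SemigroupPseudovariety.ContainedInCS.equidivisible {V : SemigroupPseudovariety.{u}}
    (hV : V.ContainedInCS) : V.Equidivisible := by
  intro A _ _
  refine isEquidivisible_freePro fun u v x y huv c => ?_
  obtain ⟨t, h₁, h₂⟩ := (hV _ c.2).exists_refinement (congrFun (congrArg Subtype.val huv) c)
  exact ⟨t, Or.inl ⟨by rw [← h₁, WithOne.coe_mul], by rw [h₂, WithOne.coe_mul]⟩⟩

/-! ### Closure under the expansion implies equidivisibility -/

namespace KarnofskyRhodes

variable {A S : Type u} [Semigroup S]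

theorem reachable_of_append (φ : FreeSemigroup A →ₙ* S) (l₁ m l₂ : List A) :
    Reachable φ (val φ l₁, val φ (m ++ l₂)) (val φ (l₁ ++ m), val φ l₂) := by
  rw [val_append, val_append]
  exact reachable_val _ _ _ _

/-- Two vertices on one path are joined by a path. -/
theorem reachable_or_reachable (φ : FreeSemigroup A →ₙ* S) {l₁ l₂ m₁ m₂ : List A}
    (h : l₁ ++ l₂ = m₁ ++ m₂) :
    Reachable φ (val φ l₁, val φ l₂) (val φ m₁, val φ m₂) ∨
      Reachable φ (val φ m₁, val φ m₂) (val φ l₁, val φ l₂) := by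
  rw [List.append_eq_append_iff] at h
  rcases h with ⟨k, rfl, rfl⟩ | ⟨k, rfl, rfl⟩
  · exact Or.inl (reachable_of_append _ _ _ _)
  · exact Or.inr (reachable_of_append _ _ _ _)

/-- Every vertex on the path `p_w` can reach the initial vertex or the target of some transition
edge that precedes it. -/
theorem reachable_start_or_transitionEdge (φ : FreeSemigroup A →ₙ* S) (w : FreeSemigroup A)
    (l₁ l₂ : List A) (h : letters w = l₁ ++ l₂) :
    Reachable φ (val φ l₁, val φ l₂) (1, val φ (letters w)) ∨
      ∃ e ∈ transitionEdges φ w, Reachable φ e.2.2 (val φ l₁, val φ l₂) ∧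
        Reachable φ (val φ l₁, val φ l₂) e.2.2 := by
  induction l₁ using List.reverseRecOn generalizing l₂ with
  | nil =>
    left
    rw [h, val_nil]
    exact Relation.ReflTransGen.refl
  | append_singleton l₁ a ih =>
    have h' : letters w = l₁ ++ a :: l₂ := by simpa using h
    by_cases hr : Reachable φ (val φ (l₁ ++ [a]), val φ l₂) (val φ l₁, val φ (a :: l₂))
    · rcases ih _ h' with h₁ | ⟨e, he, h₁, h₂⟩
      · exact Or.inl (hr.trans h₁)
      · exact Or.inr ⟨e, he, h₁.trans (reachable_of_append φ l₁ [a] l₂), hr.trans h₂⟩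
    · have hp : ((val φ l₁, val φ (a :: l₂)), a, (val φ (l₁ ++ [a]), val φ l₂)) ∈ pathEdges φ w :=
        ⟨l₁, a, l₂, h', rfl⟩
      exact Or.inr ⟨_, ⟨hp, isEdge_of_mem_pathEdges hp, fun h => hr h.2⟩,
        Relation.ReflTransGen.refl, Relation.ReflTransGen.refl⟩

/-- If `w ≡_φ w'`, then any vertices of the paths `p_w` and `p_w'` are joined by a path. -/
theorem reachable_or_reachable_of_congruence (φ : FreeSemigroup A →ₙ* S) {w w' : FreeSemigroup A}
    (hw : congruence φ w w') {l₁ l₂ m₁ m₂ : List A} (hl : letters w = l₁ ++ l₂)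
    (hm : letters w' = m₁ ++ m₂) :
    Reachable φ (val φ l₁, val φ l₂) (val φ m₁, val φ m₂) ∨
      Reachable φ (val φ m₁, val φ m₂) (val φ l₁, val φ l₂) := by
  rcases reachable_start_or_transitionEdge φ w l₁ l₂ hl with h | ⟨e, he, h₁, h₂⟩
  · refine Or.inl (h.trans ?_)
    rw [val_letters, hw.1, ← val_letters, hm, ← val_nil φ]
    exact reachable_of_append φ [] m₁ m₂
  -- The vertex is strongly connected to the target of a transition edge, which also lies on `p_w'`
  -- and is therefore comparable with every vertex there.
  · rw [hw.2] at he
    obtain ⟨⟨k₁, a, k₂, hk, rfl⟩, -⟩ := he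
    have hk' : (k₁ ++ [a]) ++ k₂ = m₁ ++ m₂ := by rw [← hm, hk]; simp
    rcases reachable_or_reachable φ hk' with h | h
    · exact Or.inl (h₂.trans h)
    · exact Or.inr (h.trans h₁)

end KarnofskyRhodes

theorem SemigroupPseudovariety.ClosedUnderKR.equidivisible {V : SemigroupPseudovariety.{u}}
    (hV : V.ClosedUnderKR) : V.Equidivisible := by
  intro A _ _
  refine isEquidivisible_freePro fun u v x y huv c => ?_
  let φ := quotientHom c.1
  have hφ : Function.Surjective φ := quotientHom_surjective c.1
  -- The equality is used at this finer level `d`, the refinement obtained at level `c`.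
  let d : V.FreeIndex A := ⟨congruence φ, hV A _ φ hφ c.2⟩
  have hdc : d.1 ≤ c.1 := fun x y h => quotientHom_eq_iff.1 h.1
  have hw : ∀ z : V.freePro A, ∃ w, quotientHom d.1 w = z.1 d ∧ φ w = z.1 c := by
    intro z
    obtain ⟨w, hw⟩ := quotientHom_surjective d.1 (z.1 d)
    exact ⟨w, hw, by rw [← z.2 d c hdc, ← hw]; rfl⟩
  obtain ⟨u', hu, hu'⟩ := hw u
  obtain ⟨v', hv, hv'⟩ := hw v
  obtain ⟨x', hx, hx'⟩ := hw x
  obtain ⟨y', hy, hy'⟩ := hw y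
  have hcong : congruence φ (u' * v') (x' * y') := by
    refine (quotientHom_eq_iff (c := d.1)).1 ?_
    rw [map_mul, map_mul, hu, hv, hx, hy]
    exact congrFun (congrArg Subtype.val huv) d
  have := reachable_or_reachable_of_congruence φ hcong (letters_mul u' v') (letters_mul x' y')
  simp only [val_letters, reachable_iff hφ, hu', hv', hx', hy'] at this
  exact exists_or.2 this

/-! ### Irreducible letters and the converse -/

namespace List

/-- If a property of the splittings of a list holds for the first splitting and fails for the last
one, then some letter separates a splitting where it holds from one where it fails. -/
theorem exists_splitting_step {α : Type*} (Q : List α → List α → Prop) (l : List α)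
    (h₁ : Q [] l) (h₂ : ¬ Q l []) :
    ∃ l₁ b l₂, l = l₁ ++ b :: l₂ ∧ Q l₁ (b :: l₂) ∧ ¬ Q (l₁ ++ [b]) l₂ := by
  suffices H : ∀ k m, Q k m → ¬ Q (k ++ m) [] →
      ∃ l₁ b l₂, k ++ m = l₁ ++ b :: l₂ ∧ Q l₁ (b :: l₂) ∧ ¬ Q (l₁ ++ [b]) l₂ from H [] l h₁ h₂
  intro k m
  induction m generalizing k with
  | nil => exact fun h₁ h₂ => absurd h₁ (by simpa using h₂)
  | cons b m ih =>
    intro h₁ h₂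
    by_cases h : Q (k ++ [b]) m
    · simpa using ih (k ++ [b]) h (by simpa using h₂)
    · exact ⟨k, b, m, rfl, h₁, h⟩

end List

namespace SemigroupPseudovariety

variable {V : SemigroupPseudovariety.{u}} {A : Type u}

/-- Some member of `V` has an element that is not a product. -/
def HasIndecomposable (V : SemigroupPseudovariety.{u}) : Prop :=
  ∃ (N : Type u) (_ : Semigroup N), V.Mem N ∧ ∃ n : N, ∀ x y : N, x * y ≠ n

variable (V) in
/-- The image of a letter in the free pro-`V` semigroup with an identity adjoined. -/
def letter (a : A) : WithOne (V.freePro A) :=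
  (wordHom (V := V) (FreeSemigroup.of a) : WithOne (V.freePro A))

theorem letter_ne_one (a : A) : V.letter a ≠ 1 := WithOne.coe_ne_one

section Letters

variable [Nonempty A]

/-- Sending all letters to an indecomposable `n` would make `n` a product. -/
theorem HasIndecomposable.eq_one_or_eq_one (hV : V.HasIndecomposable) {a : A}
    {x y : WithOne (V.freePro A)} (h : x * y = V.letter a) : x = 1 ∨ y = 1 := by
  obtain ⟨N, _, hN, n, hn⟩ := hV
  induction x with
  | one => exact Or.inl rfl
  | coe x =>
  induction y with
  | one => exact Or.inr rfl
  | coe y =>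
  exfalso
  rw [letter, ← WithOne.coe_mul, WithOne.coe_inj] at h
  refine hn _ _ ((map_mul (extend hN (FreeSemigroup.lift fun _ : A => n)) x y).symm.trans ?_)
  rw [h, extend_wordHom, FreeSemigroup.lift_of]

theorem HasIndecomposable.letter_injective (hV : V.HasIndecomposable) :
    Function.Injective (V.letter (A := A)) := by
  classical
  obtain ⟨N, _, hN, n, hn⟩ := hV
  intro a b h
  by_contra hab
  rw [letter, letter, WithOne.coe_inj] at h
  have h' := congrArg (extend hN (FreeSemigroup.lift fun z : A => if z = a then n else n * n)) h
  rw [extend_wordHom, extend_wordHom, FreeSemigroup.lift_of, FreeSemigroup.lift_of, if_pos rfl,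
    if_neg (Ne.symm hab)] at h'
  exact hn _ _ h'.symm

theorem eq_one_or_of_letter_mul_eq (hV : V.HasIndecomposable) (hF : IsEquidivisible (V.freePro A))
    {a : A} {x t y : WithOne (V.freePro A)}
    (h : V.letter a * x = t * y) : t = 1 ∨ ∃ s, t = V.letter a * s ∧ x = s * y := by
  obtain ⟨s, ⟨h₁, h₂⟩ | ⟨h₁, h₂⟩⟩ := hF.withOne h
  · exact Or.inr ⟨s, h₁.symm, h₂⟩
  · rcases hV.eq_one_or_eq_one h₁ with rfl | rfl
    · exact Or.inl rfl
    · exact Or.inr ⟨1, by rw [mul_one, ← h₁, mul_one], by rw [h₂, one_mul, one_mul]⟩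

theorem letter_mul_cancel (hV : V.HasIndecomposable) (hF : IsEquidivisible (V.freePro A))
    {a b : A} {x y : WithOne (V.freePro A)}
    (h : V.letter a * x = V.letter b * y) : a = b ∧ x = y := by
  rcases eq_one_or_of_letter_mul_eq hV hF h with h | ⟨s, h₁, h₂⟩
  · exact absurd h (letter_ne_one b)
  · rcases hV.eq_one_or_eq_one h₁.symm with h | rfl
    · exact absurd h (letter_ne_one a)
    · exact ⟨hV.letter_injective (by rw [h₁, mul_one]), by rw [h₂, one_mul]⟩

/-- Comparison of two occurrences of letters in an element of the free pro-`V` semigroup. -/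
theorem compare_letters (hV : V.HasIndecomposable) (hF : IsEquidivisible (V.freePro A))
    {a b : A} {u₁ u₂ v₁ v₂ : WithOne (V.freePro A)}
    (h : u₁ * (V.letter a * u₂) = v₁ * (V.letter b * v₂)) :
    (u₁ = v₁ ∧ a = b ∧ u₂ = v₂) ∨
      (∃ s, v₁ = u₁ * V.letter a * s ∧ u₂ = s * (V.letter b * v₂)) ∨
      (∃ s, u₁ = v₁ * V.letter b * s ∧ v₂ = s * (V.letter a * u₂)) := by
  obtain ⟨t, ⟨h₁, h₂⟩ | ⟨h₁, h₂⟩⟩ := hF.withOne h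
  · rcases eq_one_or_of_letter_mul_eq hV hF h₂ with rfl | ⟨s, rfl, hs⟩
    · rw [one_mul] at h₂
      exact Or.inl ⟨by rw [← h₁, mul_one], letter_mul_cancel hV hF h₂⟩
    · exact Or.inr (Or.inl ⟨s, by rw [← h₁, mul_assoc], hs⟩)
  · rcases eq_one_or_of_letter_mul_eq hV hF h₂ with rfl | ⟨s, rfl, hs⟩
    · rw [one_mul] at h₂
      obtain ⟨h₃, h₄⟩ := letter_mul_cancel hV hF h₂
      exact Or.inl ⟨by rw [← h₁, mul_one], h₃.symm, h₄.symm⟩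
    · exact Or.inr (Or.inr ⟨s, by rw [← h₁, mul_assoc], hs⟩)

end Letters

theorem IsLim.append_cons [Nonempty A] {l₁ l₂ : V.FreeIndex A → List A} {a : V.FreeIndex A → A}
    {a₀ : A} {x y : WithOne (V.freePro A)} (h₁ : IsLim l₁ x) (h₂ : IsLim l₂ y)
    (ha : ∀ᶠ c in indexUltrafilter V A, a c = a₀) :
    IsLim (fun c => l₁ c ++ a c :: l₂ c) (x * (V.letter a₀ * y)) := by
  have h := h₁.append ((IsLim.const [a₀]).append h₂)
  rw [val_singleton] at h
  refine h.congr (ha.mono fun c hc => ?_)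
  rw [hc, List.singleton_append]

/-- If `w` is not below `w'` in transition edges, then there are a transition edge of `p_w` outside
`p_w'`, and an edge of `p_w'` whose source, but not its target, can reach the source of the former
edge. -/
theorem exists_splittings {S : Type u} [Semigroup S] (φ : FreeSemigroup A →ₙ* S)
    {w w' : FreeSemigroup A} (hw : φ w = φ w')
    (h : ¬ transitionEdges φ w ⊆ transitionEdges φ w') :
    ∃ (l₁ : List A) (a : A) (l₂ : List A) (m₁ : List A) (b : A) (m₂ : List A),
      letters w = l₁ ++ a :: l₂ ∧ letters w' = m₁ ++ b :: m₂ ∧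
      ((val φ l₁, val φ (a :: l₂)), a, (val φ (l₁ ++ [a]), val φ l₂)) ∉ pathEdges φ w' ∧
      ¬ Reachable φ (val φ (l₁ ++ [a]), val φ l₂) (val φ l₁, val φ (a :: l₂)) ∧
      Reachable φ (val φ m₁, val φ (b :: m₂)) (val φ l₁, val φ (a :: l₂)) ∧
      ¬ Reachable φ (val φ (m₁ ++ [b]), val φ m₂) (val φ l₁, val φ (a :: l₂)) := by
  obtain ⟨_, ⟨⟨l₁, a, l₂, hl, rfl⟩, ht⟩, he⟩ := Set.not_subset.1 h
  have hnr : ¬ Reachable φ (val φ (l₁ ++ [a]), val φ l₂) (val φ l₁, val φ (a :: l₂)) :=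
    fun h => ht.2 ⟨reachable_of_append φ l₁ [a] l₂, h⟩
  have hval : val φ (letters w') = val φ (letters w) := by rw [val_letters, val_letters, hw]
  -- The common start of the paths reaches the source of the chosen transition edge; their common
  -- end does not, since the target of that edge reaches the end.
  obtain ⟨m₁, b, m₂, hm, h₁, h₂⟩ := List.exists_splitting_step
    (fun k m => Reachable φ (val φ k, val φ m) (val φ l₁, val φ (a :: l₂))) (letters w')
    (by
      rw [hval, hl]
      exact reachable_of_append φ [] l₁ (a :: l₂))
    (by
      intro h
      refine hnr (Relation.ReflTransGen.trans (show Reachable φ _ _ from ?_) h)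
      rw [hval, hl]
      simpa using reachable_of_append φ (l₁ ++ [a]) l₂ [])
  exact ⟨l₁, a, l₂, m₁, b, m₂, hl, hm, fun h => he ⟨h, ht⟩, hnr, h₁, h₂⟩

/-- An equidivisible pseudovariety some member of which has an indecomposable element is closed
under the two-sided Karnofsky-Rhodes expansion. -/
theorem Equidivisible.closedUnderKR (hE : V.Equidivisible) (hV : V.HasIndecomposable) :
    V.ClosedUnderKR := by
  intro A S _ _ φ hφ hS
  obtain ⟨s₀⟩ := V.nonempty_of_mem S hS
  have : Nonempty A := ⟨(hφ s₀).choose.head⟩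
  have hF := hE A
  by_contra hnot
  have h₁ : ∀ c : V.FreeIndex A, ∃ w w', c.1 w w' ∧
      (φ w = φ w' → ¬ transitionEdges φ w ⊆ transitionEdges φ w') := by
    intro c
    by_contra! h
    refine hnot (mem_quotient_of_le (fun w w' hc => ?_) c.2)
    obtain ⟨h₁, h₂⟩ := h w w' hc
    exact ⟨h₁, h₂.antisymm (h w' w (c.1.symm hc)).2⟩
  choose w w' hc hT using h₁
  have h₂ : ∀ᶠ c in indexUltrafilter V A, φ (w c) = φ (w' c) :=
    (eventually_le (kerIndex hS φ)).mono fun c h => h (hc c)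
  -- Splittings are needed at every index to form limits; the default values where `φ (w c) ≠ φ (w'
  -- c)` are invisible to the ultrafilter.
  have h₃ := fun c => show ∃ (l₁ : List A) (a : A) (l₂ : List A) (m₁ : List A) (b : A)
    (m₂ : List A), φ (w c) = φ (w' c) → _ from by
      by_cases h : φ (w c) = φ (w' c)
      · obtain ⟨l₁, a, l₂, m₁, b, m₂, h'⟩ := exists_splittings φ h (hT c h)
        exact ⟨l₁, a, l₂, m₁, b, m₂, fun _ => h'⟩
      · exact ⟨[], Classical.arbitrary A, [], [], Classical.arbitrary A, [], fun h' => absurd h' h⟩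
  choose l₁ a l₂ m₁ b m₂ h₃ using h₃
  obtain ⟨a₀, ha⟩ := (indexUltrafilter V A).exists_eventually_eq a
  obtain ⟨b₀, hb⟩ := (indexUltrafilter V A).exists_eventually_eq b
  obtain ⟨u₁, hu₁⟩ := exists_isLim l₁
  obtain ⟨u₂, hu₂⟩ := exists_isLim l₂
  obtain ⟨v₁, hv₁⟩ := exists_isLim m₁
  obtain ⟨v₂, hv₂⟩ := exists_isLim m₂
  have heq : u₁ * (V.letter a₀ * u₂) = v₁ * (V.letter b₀ * v₂) := by
    refine ((hu₁.append_cons hu₂ ha).congr ?_).unique (hv₁.append_cons hv₂ hb)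
    filter_upwards [h₂] with c hφc
    obtain ⟨hw, hw', -⟩ := h₃ c hφc
    rw [← hw, ← hw', val_letters, val_letters, quotientHom_eq_iff.2 (hc c)]
  let Φ := WithOne.mapMulHom (extend hS φ)
  have hΦ (x : A) : (φ (FreeSemigroup.of x) : WithOne S) = Φ (V.letter x) := rfl
  obtain ⟨c, hφc, hac, hbc, e₁, e₂, e₃, e₄⟩ := (h₂.and (ha.and (hb.and
    ((hu₁.eventually_val hS φ).and ((hu₂.eventually_val hS φ).and
    ((hv₁.eventually_val hS φ).and (hv₂.eventually_val hS φ))))))).exists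
  change _ = Φ _ at e₁ e₂ e₃ e₄
  obtain ⟨hw, hw', hp, hn₁, hr, hn₂⟩ := h₃ c hφc
  rw [hac] at hp hn₁ hr hn₂
  rw [hbc] at hr hn₂ hw'
  -- Same position: the transition edge lies on `p_w'`. Letter `a₀` first: its edge can be undone
  -- through the source of the `b₀`-edge. Letter `b₀` first: the target of its edge still reaches
  -- the source of the `a₀`-edge.
  rcases compare_letters hV hF heq with ⟨rfl, rfl, rfl⟩ | ⟨s, hs₁, hs₂⟩ | ⟨s, hs₁, hs₂⟩
  · refine hp ⟨m₁ c, a₀, m₂ c, hw', ?_⟩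
    simp only [val_append, val_cons, e₁, e₂, e₃, e₄]
  · refine hn₁ (Relation.ReflTransGen.trans ((reachable_iff hφ).2 ⟨Φ s, ?_, ?_⟩) hr)
    · simp only [val_append, val_singleton, e₁, e₃, hs₁, map_mul, hΦ]
    · simp only [val_cons, e₂, e₄, hs₂, map_mul, hΦ]
  · refine hn₂ ((reachable_iff hφ).2 ⟨Φ s, ?_, ?_⟩)
    · simp only [val_append, val_singleton, e₁, e₃, hs₁, map_mul, hΦ]
    · simp only [val_cons, e₂, e₄, hs₂, map_mul, hΦ]

end SemigroupPseudovariety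

/-! ### Pseudovarieties outside CS without indecomposable elements -/

theorem Semigroup.exists_idempotent_of_finite (S : Type*) [Semigroup S] [Finite S] [Nonempty S] :
    ∃ e : S, e * e = e := by
  let _ : TopologicalSpace S := ⊥
  have : DiscreteTopology S := ⟨rfl⟩
  exact exists_idempotent_of_compact_t2_of_continuous_mul_left fun _ => continuous_of_discreteTopology

/-- The Rees congruence of a two-sided ideal. -/
def reesCon {S : Type u} [Semigroup S] (J : Set S) (hJ : ∀ s : S, ∀ x ∈ J, s * x ∈ J ∧ x * s ∈ J) :
    Con S where
  r x y := x = y ∨ (x ∈ J ∧ y ∈ J)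
  iseqv := ⟨fun _ => Or.inl rfl, fun h => h.imp Eq.symm And.symm, by
    rintro x y z (rfl | ⟨h₁, h₂⟩) (rfl | ⟨h₃, h₄⟩)
    exacts [Or.inl rfl, Or.inr ⟨h₃, h₄⟩, Or.inr ⟨h₁, h₂⟩, Or.inr ⟨h₁, h₄⟩]⟩
  mul' := by
    rintro w x y z (rfl | ⟨h₁, h₂⟩) (rfl | ⟨h₃, h₄⟩)
    exacts [Or.inl rfl, Or.inr ⟨(hJ _ _ h₃).1, (hJ _ _ h₄).1⟩,
      Or.inr ⟨(hJ _ _ h₁).2, (hJ _ _ h₂).2⟩, Or.inr ⟨(hJ _ _ h₁).2, (hJ _ _ h₂).2⟩]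

namespace SemigroupPseudovariety

variable {V : SemigroupPseudovariety.{u}}

/-- Some nontrivial member of `V` has a zero. -/
def HasNontrivialZero (V : SemigroupPseudovariety.{u}) : Prop :=
  ∃ (T : Type u) (_ : Semigroup T), V.Mem T ∧ ∃ e f : T, e ≠ f ∧ ∀ x : T, x * f = f ∧ f * x = f

/-- A proper ideal gives a Rees quotient; a nonprimitive idempotent `e` with f < e gives the
subsemigroup {e, f}. -/
theorem hasNontrivialZero_of_not_containedInCS (hV : ¬ V.ContainedInCS) :
    V.HasNontrivialZero := by
  simp only [ContainedInCS, not_forall] at hV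
  obtain ⟨T, _, hT, hCS⟩ := hV
  rw [IsCompletelySimple, not_and_or] at hCS
  rcases hCS with hJ | hprim
  · push Not at hJ
    obtain ⟨J, ⟨j, hj⟩, hJ, hne⟩ := hJ
    obtain ⟨s, hs⟩ := (Set.ne_univ_iff_exists_notMem J).1 hne
    refine ⟨(reesCon J hJ).Quotient, inferInstance,
      V.mem_image _ _ ⟨fun x : T => (x : (reesCon J hJ).Quotient), fun _ _ => rfl⟩
        Quotient.mk''_surjective hT, (s : (reesCon J hJ).Quotient), (j : (reesCon J hJ).Quotient),
        ?_, ?_⟩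
    · intro h
      rcases (Con.eq _).1 h with rfl | h
      exacts [hs hj, hs h.1]
    · rintro ⟨x⟩
      exact ⟨(Con.eq _).2 (Or.inr ⟨(hJ x j hj).1, hj⟩), (Con.eq _).2 (Or.inr ⟨(hJ x j hj).2, hj⟩)⟩
  · have := V.finite_of_mem T hT
    have := V.nonempty_of_mem T hT
    obtain ⟨e, he⟩ := Semigroup.exists_idempotent_of_finite T
    push Not at hprim
    obtain ⟨f, hf, hef, hfe, hne⟩ := hprim e he
    let P : Subsemigroup T :=
      { carrier := {e, f}
        mul_mem' := by
          rintro x y (rfl | rfl) (rfl | rfl)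
          exacts [Or.inl he, Or.inr hef, Or.inr hfe, Or.inr hf] }
    refine ⟨P, inferInstance, V.mem_subsemigroup T hT P ⟨e, Or.inl rfl⟩, ⟨e, Or.inl rfl⟩,
      ⟨f, Or.inr rfl⟩, fun h => hne (congrArg Subtype.val h).symm, ?_⟩
    rintro ⟨x, rfl | rfl⟩
    exacts [⟨Subtype.ext hef, Subtype.ext hfe⟩, ⟨Subtype.ext hf, Subtype.ext hf⟩]

/-- The generator `s` must be a product inside the monogenic subsemigroup it generates, hence a
power of itself with exponent at least 2. -/
theorem exists_eq_mul_self_mul (hV : ¬ V.HasIndecomposable) {T : Type u} [Semigroup T]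
    (hT : V.Mem T) (s : T) : ∃ z, s * s * z = s := by
  have hC : ∀ x ∈ Subsemigroup.closure {s},
      x = s ∨ ∃ x' ∈ Subsemigroup.closure {s}, x = s * x' := by
    intro x hx
    induction hx using Subsemigroup.closure_induction with
    | mem x hx => exact Or.inl hx
    | mul x y _ hy ihx _ =>
      rcases ihx with rfl | ⟨x', hx', rfl⟩
      · exact Or.inr ⟨y, hy, rfl⟩
      · exact Or.inr ⟨x' * y, mul_mem hx' hy, mul_assoc _ _ _⟩
  have hs : s ∈ Subsemigroup.closure {s} := Subsemigroup.subset_closure rfl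
  have h : ∃ y ∈ Subsemigroup.closure {s}, s = s * y := by
    by_contra! hn
    refine hV ⟨Subsemigroup.closure {s}, inferInstance, V.mem_subsemigroup T hT _ ⟨s, hs⟩,
      ⟨s, hs⟩, ?_⟩
    rintro ⟨x, hx⟩ ⟨y, hy⟩ h
    have hxy : x * y = s := congrArg Subtype.val h
    rcases hC x hx with rfl | ⟨x', hx', rfl⟩
    · exact hn y hy hxy.symm
    · exact hn (x' * y) (mul_mem hx' hy) (by rw [← mul_assoc, hxy])
  obtain ⟨y, hy, h⟩ := h
  rcases hC y hy with rfl | ⟨z, -, rfl⟩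
  · exact ⟨y, by rw [← h, ← h]⟩
  · exact ⟨z, by rw [mul_assoc, ← h]⟩

/-- If all elements of members of `V` are products, then `V` is not equidivisible, as soon as
some nontrivial member of `V` has a zero. -/
theorem HasNontrivialZero.not_equidivisible (hV : V.HasNontrivialZero)
    (hI : ¬ V.HasIndecomposable) : ¬ V.Equidivisible := by
  intro hE
  obtain ⟨T, _, hT, e, f, hne, hf⟩ := hV
  let A := ULift.{u} Bool
  have hF := hE A
  let p : WithOne (V.freePro A) := V.letter ⟨true⟩ * V.letter ⟨false⟩
  obtain ⟨z, hz⟩ : ∃ z, p * (p * z) = p := by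
    obtain ⟨z, hz⟩ := exists_forall_projOne (V := V) (A := A)
      (fun c t => projOne c p * (projOne c p * t) = projOne c p)
      (fun c d h t ht => by
        have ht := congrArg (WithOne.mapMulHom (conProj h)) ht
        simpa only [map_mul, mapMulHom_conProj_projOne] using ht)
      (Eventually.of_forall fun c => by
        obtain ⟨t, ht⟩ := exists_eq_mul_self_mul hI c.2
          (quotientHom c.1 (FreeSemigroup.of ⟨true⟩ * FreeSemigroup.of ⟨false⟩))
        exact ⟨t, (mul_assoc _ _ _).symm.trans (congrArg WithOne.coe ht)⟩)
    exact ⟨z, projOne_ext fun c => by simpa only [map_mul] using hz c⟩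
  have hf₁ : ∀ x : WithOne T, x * f = f := fun x => by
    induction x with
    | one => exact one_mul _
    | coe x => rw [← WithOne.coe_mul, (hf x).1]
  have hf₂ : ∀ x : WithOne T, f * x = f := fun x => by
    induction x with
    | one => exact mul_one _
    | coe x => rw [← WithOne.coe_mul, (hf x).2]
  let Ψ (g : A → T) : WithOne (V.freePro A) →* WithOne T :=
    WithOne.mapMulHom (extend hT (FreeSemigroup.lift g))
  have hΨ (g : A → T) (a : A) : Ψ g (V.letter a) = (g a : WithOne T) := rfl
  obtain ⟨t, ⟨-, h⟩ | ⟨h, -⟩⟩ := hF.withOne hz.symm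
  -- Here b = t(abz): sending a to the zero `f` and b to `e` gives e = f. The other case, abt = a,
  -- uses the opposite assignment.
  · have h' := congrArg (Ψ fun a => if a.down then f else e) h
    simp only [p, map_mul, hΨ, if_true, Bool.false_eq_true, if_false, hf₁, hf₂, ← mul_assoc] at h'
    exact hne (WithOne.coe_inj.1 h')
  · have h' := congrArg (Ψ fun a => if a.down then e else f) h
    simp only [p, map_mul, hΨ, if_true, Bool.false_eq_true, if_false, hf₁, hf₂] at h'
    exact hne (WithOne.coe_inj.1 h').symm

end SemigroupPseudovariety

theorem theoremt (V : SemigroupPseudovariety.{u}) :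
    V.Equidivisible ↔ V.ContainedInCS ∨ V.ClosedUnderKR := by
  refine ⟨fun h => or_iff_not_imp_left.2 fun hCS => h.closedUnderKR ?_,
    fun h => h.elim (fun h => h.equidivisible) (fun h => h.equidivisible)⟩
  by_contra hI
  exact (SemigroupPseudovariety.hasNontrivialZero_of_not_containedInCS hCS).not_equidivisible hI h
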